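/- Let $\Delta=\{z\in\mathbb{C}:|z|<1\}$, and let $\{F_t\}_{t\ge 0}$ be a one-parameter continuous semigroup on $\Delta$: each $F_t$ is a holomorphic self-mapping of $\Delta$, $F_t\circ F_s=F_{t+s}$ for all $t,s\ge 0$, and $\lim_{t\to0^+}F_t(z)=z$ for all $z\in\Delta$. Let $\{F_t\}$ be generated by the holomorphic function $f:\Delta\to\mathbb{C}$, i.e. $f(z)=\lim_{t\to0^+}\frac{z-F_t(z)}{t}$ for all $z\in\Delta$. Let $\tau$ with $|\tau|=1$ be a boundary null point of $f$, i.e. $\lim_{r\to1^-}f(r\tau)=0$. We write $\angle\lim_{z\to\tau}h(z)=L$ if $h(z)\to L$ as $z\to\tau$ within each Stolz angle $\{z\in\Delta:|\arg(1-\overline{\tau}z)|<\theta\}$, $0<\theta<\pi/2$; and, for $h$ holomorphic in $\Delta$, we let $h^{(n)}(\tau):=\angle\lim_{z\to\tau}h^{(n)}(z)$ denote its $n$-th angular derivative at $\tau$, if this limit exists finitely. (i) If $\beta:=f'(\tau)$ exists finitely, then for each $t\ge0$ the angular derivative $F_t'(\tau)$ exists and $$F_t'(\tau)=e^{-\beta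 t}.$$ (ii) If $\alpha:=f''(\tau)$ exists finitely, then $\beta:=f'(\tau)$ exists finitely, and for each $t\ge0$ the angular derivative $F_t''(\tau)$ exists and $$F_t''(\tau)=\begin{cases}-\alpha t, & \beta=0,\\[1mm] \dfrac{\alpha}{\beta}e^{-\beta t}\left(e^{-\beta t}-1\right), & \beta\ne0.\end{cases}$$ (iii) If $\gamma:=f'''(\tau)$ exists finitely, then $\beta:=f'(\tau)$ and $\alpha:=f''(\tau)$ exist finitely, and for each $t\ge0$ the angular derivative $F_t'''(\tau)$ exists and $$F_t'''(\tau)=\begin{cases}\dfrac32\alpha^2t^2-\gamma t, & \beta=0,\\[1mm] \left(\dfrac{3\alpha^2}{2\beta^2}+\dfrac{\gamma}{2\beta}\right)e^{-3\beta t}-\dfrac{3\alpha^2}{\beta^2}e^{-2\beta t}+\left(\dfrac{3\alpha^2}{2\beta^2}-\dfrac{\gamma}{2\beta}\right)e^{-\beta t}, & \beta\ne0.\end{cases}$$ -/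

import Mathlib

open Filter Topology

/-- One-parameter continuous semigroup `{F_t}_{t ≥ 0}` of holomorphic self-mappings of the open
unit disk. Only the values `F t z` with `0 ≤ t` and `‖z‖ < 1` matter. -/
structure IsContinuousSemigroup (F : ℝ → ℂ → ℂ) : Prop where
  holo : ∀ t : ℝ, 0 ≤ t → DifferentiableOn ℂ (F t) (Metric.ball 0 1)
  mapsTo : ∀ t : ℝ, 0 ≤ t → Set.MapsTo (F t) (Metric.ball 0 1) (Metric.ball 0 1)
  comp : ∀ t s : ℝ, 0 ≤ t → 0 ≤ s → ∀ z ∈ Metric.ball (0 : ℂ) 1, F t (F s z) = F (t + s) z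
  tendsto : ∀ z ∈ Metric.ball (0 : ℂ) 1, Tendsto (fun t : ℝ => F t z) (𝓝[>] 0) (𝓝 z)

/-- The holomorphic function `f` on the unit disk is the (infinitesimal) generator of
`{F_t}`: `f z = lim_{t → 0⁺} (z - F_t z) / t`. -/
structure IsGenerator (f : ℂ → ℂ) (F : ℝ → ℂ → ℂ) : Prop where
  holo : DifferentiableOn ℂ f (Metric.ball 0 1)
  tendsto : ∀ z ∈ Metric.ball (0 : ℂ) 1,
    Tendsto (fun t : ℝ => (z - F t z) / (t : ℂ)) (𝓝[>] 0) (𝓝 (f z))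

/-- `τ` is a boundary null point of `f`: `|τ| = 1` and `lim_{r → 1⁻} f (r τ) = 0`. -/
def IsBoundaryNullPoint (f : ℂ → ℂ) (τ : ℂ) : Prop :=
  ‖τ‖ = 1 ∧ Tendsto (fun r : ℝ => f ((r : ℂ) * τ)) (𝓝[<] 1) (𝓝 0)

/-- The Stolz angle `{z : |z| < 1, |arg (1 - τ̄ z)| < θ}` at `τ`. -/
def stolzAngle (τ : ℂ) (θ : ℝ) : Set ℂ :=
  {z : ℂ | ‖z‖ < 1 ∧ |Complex.arg (1 - (starRingEnd ℂ) τ * z)| < θ}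

/-- `h` has the finite angular limit `L` at `τ`. -/
def HasAngularLimit (h : ℂ → ℂ) (τ L : ℂ) : Prop :=
  ∀ θ : ℝ, 0 < θ → θ < Real.pi / 2 → Tendsto h (𝓝[stolzAngle τ θ] τ) (𝓝 L)

/-- The `n`-th angular derivative of `h` at `τ` exists finitely and equals `L`, that is,
the `n`-th derivative of `h` has the angular limit `L` at `τ`. -/
def HasAngularDeriv (n : ℕ) (h : ℂ → ℂ) (τ L : ℂ) : Prop :=
  HasAngularLimit (iteratedDeriv n h) τ L

/-! In the disk, `∂F_t/∂t = -f(F_t)` linearises in `z` to `F_t'(z) = exp(-∫₀ᵗ f'(F_s z) ds)`, and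
differentiating this expresses `F_t''` and `F_t'''` through integrals over `[0,t]` of derivatives of
`f` along the trajectory and lower derivatives of `F_s`. If `z → τ` in a Stolz angle may be taken
under these integrals, each `f^{(k)}(F_s z)` is replaced by its angular limit, and elementary
integrals of exponentials remain.

The exchange is dominated convergence (`HasBddLimit.integral`). It requires that trajectories issued
near `τ` in a Stolz angle stay, for bounded time, near `τ` in a slightly larger one
(`IsContinuousSemigroup.eventually_mem_stolzAngle`). With `u = 1 - τ̄ F_s z`, the estimate `f(w) ≈
β(w - τ)` gives `(log u)' ≈ -β`: the modulus of `u` changes by a bounded factor, and its argument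
hardly moves provided that `β` is real.

That `β` is real (`IsGenerator.im_eq_zero`) follows from the infinitesimal Schwarz–Pick inequality,
tested along two segments ending at `τ` on either side of the radius. Finally, an angular limit of a
derivative forces one of the function, by a Lipschitz estimate on the convex Stolz angle; this
produces the lower angular derivatives of `f`. -/

/-! ### Schwarz–Pick estimates -/

open Metric Set in
/-- A holomorphic self-map of the unit disk is Lipschitz near `c`, with a constant
depending only on `c`. -/
theorem dist_le_of_mapsTo_unit_ball {g : ℂ → ℂ} (hd : DifferentiableOn ℂ g (ball 0 1))
    (hm : MapsTo g (ball 0 1) (ball 0 1)) {c z : ℂ} (hz : z ∈ ball c (1 - ‖c‖)) :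
    dist (g z) (g c) ≤ 2 / (1 - ‖c‖) * dist z c := by
  have hsub : ball c (1 - ‖c‖) ⊆ ball (0 : ℂ) 1 := ball_subset_ball' (by simp)
  have hc : c ∈ ball (0 : ℂ) 1 := hsub (mem_ball_self (pos_of_mem_ball hz))
  refine Complex.dist_le_div_mul_dist_of_mapsTo_ball (hd.mono hsub) (fun w hw => ?_) hz
  have h1 := hm (hsub hw)
  have h2 := hm hc
  rw [mem_ball_zero_iff] at h1 h2
  rw [mem_closedBall, dist_eq_norm]
  linarith [norm_sub_le (g w) (g c)]

-- Following `g` by the disk automorphism that sends `a = g 0` to `0` gives a map `h` to which the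
-- Schwarz lemma applies, and `h'(0) = g'(0) / (1 - |a|²)`.
open Metric Set in
theorem norm_deriv_zero_le_of_mapsTo_unit_ball {g : ℂ → ℂ} (hd : DifferentiableOn ℂ g (ball 0 1))
    (hm : MapsTo g (ball 0 1) (ball 0 1)) : ‖deriv g 0‖ ≤ 1 - ‖g 0‖ ^ 2 := by
  set a := g 0 with ha
  have h0 : (0 : ℂ) ∈ ball (0 : ℂ) 1 := mem_ball_self one_pos
  have ha1 : ‖a‖ < 1 := by simpa using hm h0
  have hne : ∀ w ∈ ball (0 : ℂ) 1, 1 - (starRingEnd ℂ) a * w ≠ 0 := by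
    intro w hw h
    have hw' : ‖w‖ < 1 := by simpa using hw
    have : ‖(starRingEnd ℂ) a * w‖ = 1 := by rw [← sub_eq_zero.1 h]; simp
    rw [norm_mul, Complex.norm_conj] at this
    nlinarith [norm_nonneg a, norm_nonneg w]
  set h : ℂ → ℂ := fun z => (g z - a) / (1 - (starRingEnd ℂ) a * g z) with hh
  have hhd : DifferentiableOn ℂ h (ball 0 1) :=
    (hd.sub_const _).div ((hd.const_mul _).const_sub _) (fun z hz => hne _ (hm hz))
  have hh0 : h 0 = 0 := by simp [hh, ha]
  have hhm : MapsTo h (ball 0 1) (closedBall (h 0) 1) := by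
    intro z hz
    rw [hh0, mem_closedBall_zero_iff]
    simp only [hh]
    rw [norm_div, div_le_one (norm_pos_iff.2 (hne _ (hm hz)))]
    have hw : ‖g z‖ < 1 := by simpa using hm hz
    rw [← abs_of_nonneg (norm_nonneg (g z - a)),
      ← abs_of_nonneg (norm_nonneg (1 - (starRingEnd ℂ) a * g z)), ← sq_le_sq]
    have hw2 : ‖g z‖ ^ 2 < 1 := by nlinarith [norm_nonneg (g z)]
    have ha2 : ‖a‖ ^ 2 < 1 := by nlinarith [norm_nonneg a]
    rw [Complex.sq_norm, Complex.normSq_apply] at hw2 ha2 ⊢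
    rw [Complex.sq_norm, Complex.normSq_apply]
    simp
    nlinarith
  have hb := Complex.norm_deriv_le_one_of_mapsTo_ball hhd hhm one_pos
  have hg0 : HasDerivAt g (deriv g 0) 0 := (hd.differentiableAt (ball_mem_nhds _ one_pos)).hasDerivAt
  have hder : HasDerivAt h (deriv g 0 / (1 - (starRingEnd ℂ) a * a)) 0 := by
    have := (hg0.sub_const a).div ((hg0.const_mul ((starRingEnd ℂ) a)).const_sub 1) (hne _ (hm h0))
    refine this.congr_deriv ?_
    have := hne _ (hm h0)
    rw [← ha] at this ⊢
    field_simp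
    ring
  rw [hder.deriv, norm_div] at hb
  have e : (1 - (starRingEnd ℂ) a * a : ℂ) = ((1 - ‖a‖ ^ 2 : ℝ) : ℂ) := by
    rw [mul_comm, Complex.mul_conj, Complex.normSq_eq_norm_sq]; push_cast; rfl
  have hp : 0 < 1 - ‖a‖ ^ 2 := by nlinarith [norm_nonneg a]
  rw [e, Complex.norm_real, Real.norm_of_nonneg hp.le, div_le_one hp] at hb
  exact hb

open Metric Set in
/-- The infinitesimal Schwarz–Pick inequality in the unit disk. -/
theorem norm_deriv_mul_le_of_mapsTo_unit_ball {g : ℂ → ℂ} (hd : DifferentiableOn ℂ g (ball 0 1))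
    (hm : MapsTo g (ball 0 1) (ball 0 1)) {z : ℂ} (hz : z ∈ ball (0 : ℂ) 1) :
    ‖deriv g z‖ * (1 - ‖z‖ ^ 2) ≤ 1 - ‖g z‖ ^ 2 := by
  have hz1 : ‖z‖ < 1 := by simpa using hz
  have hne : ∀ w ∈ ball (0 : ℂ) 1, 1 + (starRingEnd ℂ) z * w ≠ 0 := by
    intro w hw h
    have hw' : ‖w‖ < 1 := by simpa using hw
    have : ‖(starRingEnd ℂ) z * w‖ = 1 := by rw [← neg_eq_of_add_eq_zero_right h]; simp
    rw [norm_mul, Complex.norm_conj] at this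
    nlinarith [norm_nonneg z, norm_nonneg w]
  -- The disk automorphism with `m 0 = z` and `m'(0) = 1 - |z|²`; the bound at the origin is applied
  -- to `g ∘ m`.
  set m : ℂ → ℂ := fun u => (u + z) / (1 + (starRingEnd ℂ) z * u) with hmdef
  have hmd : DifferentiableOn ℂ m (ball 0 1) :=
    (differentiableOn_id.add_const _).div ((differentiableOn_id.const_mul _).const_add _) hne
  have hmm : MapsTo m (ball 0 1) (ball 0 1) := by
    intro w hw
    rw [mem_ball_zero_iff]
    simp only [hmdef]
    rw [norm_div, div_lt_one (norm_pos_iff.2 (hne _ hw))]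
    have hw' : ‖w‖ < 1 := by simpa using hw
    rw [← abs_of_nonneg (norm_nonneg (w + z)),
      ← abs_of_nonneg (norm_nonneg (1 + (starRingEnd ℂ) z * w)), ← sq_lt_sq]
    have hw2 : ‖w‖ ^ 2 < 1 := by nlinarith [norm_nonneg w]
    have ha2 : ‖z‖ ^ 2 < 1 := by nlinarith [norm_nonneg z]
    rw [Complex.sq_norm, Complex.normSq_apply] at hw2 ha2 ⊢
    rw [Complex.sq_norm, Complex.normSq_apply]
    simp
    nlinarith
  have key := norm_deriv_zero_le_of_mapsTo_unit_ball (hd.comp hmd hmm) (hm.comp hmm)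
  have hm0 : m 0 = z := by simp [hmdef]
  have hmder : HasDerivAt m (((1 - ‖z‖ ^ 2 : ℝ) : ℂ)) 0 := by
    have := ((hasDerivAt_id (0 : ℂ)).add_const z).div
      (((hasDerivAt_id (0 : ℂ)).const_mul ((starRingEnd ℂ) z)).const_add 1)
      (hne _ (mem_ball_self one_pos))
    refine this.congr_deriv ?_
    simp [Complex.mul_conj, Complex.normSq_eq_norm_sq]
  have hgz : HasDerivAt g (deriv g z) (m 0) := by
    rw [hm0]; exact (hd.differentiableAt (isOpen_ball.mem_nhds hz)).hasDerivAt
  have hp : 0 ≤ 1 - ‖z‖ ^ 2 := by nlinarith [norm_nonneg z]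
  rw [(hgz.comp 0 hmder).deriv, norm_mul, Complex.norm_real, Real.norm_of_nonneg hp,
    Function.comp_apply, hm0] at key
  exact key

/-! ### Joint continuity and the flow equation -/

namespace IsContinuousSemigroup

open Metric Set

variable {F : ℝ → ℂ → ℂ} {f : ℂ → ℂ}

/-- `F 0` is not assumed to be the identity: `F t (F 0 z) = F t z` for `t > 0`, and the two sides
tend to `F 0 z` and `z` as `t → 0⁺`. -/
theorem zero_apply (hF : IsContinuousSemigroup F) {z : ℂ} (hz : z ∈ ball (0 : ℂ) 1) :
    F 0 z = z := by
  have h0 := hF.mapsTo 0 le_rfl hz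
  refine tendsto_nhds_unique (hF.tendsto _ h0) ((hF.tendsto z hz).congr' ?_)
  filter_upwards [self_mem_nhdsWithin] with t ht
  rw [hF.comp t 0 (le_of_lt ht) le_rfl z hz, add_zero]

theorem tendsto_nhdsGE (hF : IsContinuousSemigroup F) {z : ℂ} (hz : z ∈ ball (0 : ℂ) 1) :
    Tendsto (fun t : ℝ => F t z) (𝓝[≥] 0) (𝓝 z) := by
  have : ContinuousWithinAt (fun t : ℝ => F t z) (Ici 0) 0 := by
    rw [← continuousWithinAt_Ioi_iff_Ici]
    simpa [ContinuousWithinAt, hF.zero_apply hz] using hF.tendsto z hz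
  simpa [ContinuousWithinAt, hF.zero_apply hz] using this

/-- Since `F t z = F s (F (t - s) z)`, the Lipschitz bound for `F s` about `z` applies. Its constant
does not depend on `s`, so continuity at time `0` spreads to all times, from the left as well as
from the right. -/
theorem dist_le (hF : IsContinuousSemigroup F) {s t : ℝ} {z : ℂ} (hs : 0 ≤ s) (hst : s ≤ t)
    (hz : z ∈ ball (0 : ℂ) 1) (hnear : F (t - s) z ∈ ball z (1 - ‖z‖)) :
    dist (F t z) (F s z) ≤ 2 / (1 - ‖z‖) * dist (F (t - s) z) z := by
  have := dist_le_of_mapsTo_unit_ball (hF.holo s hs) (hF.mapsTo s hs) hnear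
  rwa [hF.comp s (t - s) hs (sub_nonneg.2 hst) z hz, add_sub_cancel] at this

theorem continuousOn_time (hF : IsContinuousSemigroup F) {z : ℂ} (hz : z ∈ ball (0 : ℂ) 1) :
    ContinuousOn (fun t : ℝ => F t z) (Ici 0) := by
  have hz1 : 0 < 1 - ‖z‖ := by simpa using hz
  rw [Metric.continuousOn_iff]
  intro t ht ε hε
  obtain ⟨δ, hδ, h⟩ := Metric.mem_nhdsWithin_iff.1 ((hF.tendsto_nhdsGE hz)
    (ball_mem_nhds z (lt_min hz1 (by positivity : 0 < ε * (1 - ‖z‖) / 2))))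
  have main : ∀ s r : ℝ, 0 ≤ s → s ≤ r → dist r s < δ → dist (F r z) (F s z) < ε := by
    intro s r hs hsr hd
    have hmem := h ⟨(show r - s ∈ ball (0 : ℝ) δ by simpa [Real.dist_eq] using hd),
      sub_nonneg.2 hsr⟩
    rw [mem_preimage, mem_ball, lt_min_iff] at hmem
    refine (hF.dist_le hs hsr hz hmem.1).trans_lt ?_
    calc _ < 2 / (1 - ‖z‖) * (ε * (1 - ‖z‖) / 2) := by gcongr; exact hmem.2
      _ = ε := by field_simp
  refine ⟨δ, hδ, fun s hs hd => ?_⟩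
  rcases le_total s t with hst | hst
  · rw [dist_comm]; exact main s t hs hst (by rwa [dist_comm])
  · exact main t s ht hst hd

theorem continuousOn_uncurry (hF : IsContinuousSemigroup F) :
    ContinuousOn (Function.uncurry F) (Ici 0 ×ˢ ball 0 1) := by
  rintro ⟨s, z⟩ ⟨hs, hz⟩
  have hz1 : 0 < 1 - ‖z‖ := by simpa using hz
  have h1 : Tendsto (fun p : ℝ × ℂ => F p.1 z) (𝓝[Ici 0 ×ˢ ball 0 1] (s, z)) (𝓝 (F s z)) :=
    ((hF.continuousOn_time hz) s hs).tendsto.comp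
      (tendsto_nhdsWithin_of_tendsto_nhds_of_eventually_within _
        (continuous_fst.tendsto _ |>.mono_left inf_le_left)
        (by filter_upwards [self_mem_nhdsWithin] with p hp using hp.1))
  have h2 : Tendsto (fun p : ℝ × ℂ => F p.1 p.2 - F p.1 z) (𝓝[Ici 0 ×ˢ ball 0 1] (s, z))
      (𝓝 0) := by
    have hsnd : Tendsto (fun p : ℝ × ℂ => p.2) (𝓝[Ici 0 ×ˢ ball 0 1] (s, z)) (𝓝 z) :=
      (continuous_snd.tendsto _).mono_left inf_le_left
    refine squeeze_zero_norm' (a := fun p : ℝ × ℂ => 2 / (1 - ‖z‖) * dist p.2 z) ?_ ?_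
    · filter_upwards [self_mem_nhdsWithin, hsnd (ball_mem_nhds z hz1)] with p hp hp2
      rw [← dist_eq_norm]
      exact dist_le_of_mapsTo_unit_ball (hF.holo _ hp.1) (hF.mapsTo _ hp.1) hp2
    · have := (hsnd.dist (tendsto_const_nhds (x := z))).const_mul (2 / (1 - ‖z‖))
      simpa using this
  simpa [ContinuousWithinAt, Function.uncurry_def] using h2.add h1

theorem hasDerivWithinAt (hF : IsContinuousSemigroup F) (hf : IsGenerator f F) {t : ℝ}
    (ht : 0 ≤ t) {z : ℂ} (hz : z ∈ ball (0 : ℂ) 1) :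
    HasDerivWithinAt (fun s => F s z) (-f (F t z)) (Ici t) t := by
  have hw := hF.mapsTo t ht hz
  rw [← hasDerivWithinAt_Ioi_iff_Ici, hasDerivWithinAt_iff_tendsto_slope' (by simp)]
  have h1 : Tendsto (fun s : ℝ => s - t) (𝓝[>] t) (𝓝[>] 0) := by
    refine tendsto_nhdsWithin_of_tendsto_nhds_of_eventually_within _ ?_ ?_
    · have : Tendsto (fun s : ℝ => s - t) (𝓝 t) (𝓝 (t - t)) :=
        (continuous_id.sub continuous_const).tendsto t
      rw [sub_self] at this
      exact this.mono_left inf_le_left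
    · filter_upwards [self_mem_nhdsWithin] with s hs using sub_pos.2 (mem_Ioi.1 hs)
  refine ((hf.tendsto _ hw).comp h1).neg.congr' ?_
  filter_upwards [self_mem_nhdsWithin] with s hs
  have hs' : 0 ≤ s - t := sub_nonneg.2 (le_of_lt hs)
  simp only [Function.comp_apply, slope_def_module]
  rw [hF.comp _ _ hs' ht z hz, sub_add_cancel, Complex.real_smul, Complex.ofReal_inv]
  ring

end IsContinuousSemigroup

/-! ### Holomorphic families and differentiation under the integral -/

/-- A family of holomorphic functions on the unit disk, indexed by `s ≥ 0`, which is jointly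
continuous. -/
structure IsHoloFamily (G : ℝ → ℂ → ℂ) : Prop where
  holo : ∀ s : ℝ, 0 ≤ s → DifferentiableOn ℂ (G s) (Metric.ball 0 1)
  cont : ContinuousOn (Function.uncurry G) (Set.Ici 0 ×ˢ Metric.ball 0 1)

namespace IsHoloFamily

open Metric Set

variable {G H : ℝ → ℂ → ℂ}

theorem hasDerivAt (hG : IsHoloFamily G) {s : ℝ} (hs : 0 ≤ s) {z : ℂ}
    (hz : z ∈ ball (0 : ℂ) 1) : HasDerivAt (G s) (deriv (G s) z) z :=
  ((hG.holo s hs).differentiableAt (isOpen_ball.mem_nhds hz)).hasDerivAt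

theorem continuousOn_time (hG : IsHoloFamily G) {z : ℂ} (hz : z ∈ ball (0 : ℂ) 1) :
    ContinuousOn (fun s => G s z) (Ici 0) :=
  hG.cont.comp (f := fun s : ℝ => (s, z)) (by fun_prop) (fun _ hs => ⟨hs, hz⟩)

theorem intervalIntegrable (hG : IsHoloFamily G) {z : ℂ} (hz : z ∈ ball (0 : ℂ) 1) {t : ℝ}
    (ht : 0 ≤ t) : IntervalIntegrable (fun s => G s z) MeasureTheory.volume 0 t :=
  ((hG.continuousOn_time hz).mono (by
    rw [uIcc_of_le ht]; exact Icc_subset_Ici_self)).intervalIntegrable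

/-- Joint continuity amounts to locally uniform convergence `G r → G s` as `r → s`, which passes to
derivatives by Weierstrass' theorem. -/
theorem deriv (hG : IsHoloFamily G) : IsHoloFamily (fun s => deriv (G s)) where
  holo s hs := (hG.holo s hs).deriv isOpen_ball
  cont := by
    rintro ⟨s, z⟩ ⟨hs, hz⟩
    have hlu : TendstoLocallyUniformlyOn G (G s) (𝓝[Ici 0] s) (ball 0 1) := by
      rw [isOpen_ball.tendstoLocallyUniformlyOn_iff_forall_tendsto]
      intro w hw
      have h1 : Tendsto (fun y : ℝ × ℂ => G s y.2) (𝓝[Ici 0] s ×ˢ 𝓝 w) (𝓝 (G s w)) :=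
        ((hG.hasDerivAt hs hw).continuousAt.tendsto).comp tendsto_snd
      have h2 : Tendsto (fun y : ℝ × ℂ => G y.1 y.2) (𝓝[Ici 0] s ×ˢ 𝓝 w) (𝓝 (G s w)) := by
        have := hG.cont (s, w) ⟨hs, hw⟩
        rwa [ContinuousWithinAt, nhdsWithin_prod_eq, isOpen_ball.nhdsWithin_eq hw] at this
      exact ((h1.prodMk_nhds h2).mono_right (nhds_le_uniformity _))
    have hd := hlu.deriv (by filter_upwards [self_mem_nhdsWithin] with r hr using hG.holo r hr)
      isOpen_ball
    rw [isOpen_ball.tendstoLocallyUniformlyOn_iff_forall_tendsto] at hd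
    have h3 : Tendsto (fun y : ℝ × ℂ => _root_.deriv (G s) y.2) (𝓝[Ici 0] s ×ˢ 𝓝 z)
        (𝓝 (_root_.deriv (G s) z)) :=
      ((((hG.holo s hs).deriv isOpen_ball).differentiableAt
        (isOpen_ball.mem_nhds hz)).continuousAt.tendsto).comp tendsto_snd
    rw [ContinuousWithinAt, nhdsWithin_prod_eq, isOpen_ball.nhdsWithin_eq hz]
    exact h3.congr_uniformity (hd z hz)

theorem mul (hG : IsHoloFamily G) (hH : IsHoloFamily H) :
    IsHoloFamily (fun s z => G s z * H s z) where
  holo s hs := (hG.holo s hs).mul (hH.holo s hs)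
  cont := hG.cont.mul hH.cont

theorem const_comp (hG : IsHoloFamily G) (hm : ∀ s, 0 ≤ s → MapsTo (G s) (ball 0 1) (ball 0 1))
    {f : ℂ → ℂ} (hf : DifferentiableOn ℂ f (ball 0 1)) : IsHoloFamily (fun s z => f (G s z)) where
  holo s hs := hf.comp (hG.holo s hs) (hm s hs)
  cont := hf.continuousOn.comp hG.cont (fun _ hp => hm _ hp.1 hp.2)

theorem hasDerivAt_integral (hG : IsHoloFamily G) {t : ℝ} (ht : 0 ≤ t) {z : ℂ}
    (hz : z ∈ ball (0 : ℂ) 1) :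
    HasDerivAt (fun w => ∫ s in (0 : ℝ)..t, G s w) (∫ s in (0 : ℝ)..t, _root_.deriv (G s) z) z := by
  obtain ⟨r, hr, hrs⟩ := Metric.nhds_basis_closedBall.mem_iff.1 (isOpen_ball.mem_nhds hz)
  have hK : IsCompact (Icc 0 t ×ˢ closedBall z r) := isCompact_Icc.prod (isCompact_closedBall z r)
  obtain ⟨C, hC⟩ := hK.exists_bound_of_continuousOn
    (hG.deriv.cont.mono (prod_mono Icc_subset_Ici_self hrs))
  have hI : uIoc (0 : ℝ) t = Ioc 0 t := uIoc_of_le ht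
  refine (intervalIntegral.hasDerivAt_integral_of_dominated_loc_of_deriv_le
    (F := fun w s => G s w) (F' := fun w s => _root_.deriv (G s) w) (bound := fun _ => C)
    (closedBall_mem_nhds z hr) ?_ (hG.intervalIntegrable hz ht) ?_ ?_ (by simp) ?_).2
  · filter_upwards [isOpen_ball.mem_nhds hz] with w hw
    rw [hI]
    exact (hG.intervalIntegrable hw ht).1.aestronglyMeasurable
  · rw [hI]
    exact (hG.deriv.intervalIntegrable hz ht).1.aestronglyMeasurable
  · refine Eventually.of_forall fun s hs w hw => ?_
    rw [hI] at hs
    exact hC (s, w) ⟨Ioc_subset_Icc_self hs, hw⟩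
  · refine Eventually.of_forall fun s hs w hw => ?_
    rw [hI] at hs
    exact hG.hasDerivAt hs.1.le (hrs hw)

end IsHoloFamily

open Set in
theorem hasDerivWithinAt_integral_of_continuousOn {g : ℝ → ℂ} (hg : ContinuousOn g (Ici 0)) {t : ℝ}
    (ht : 0 ≤ t) : HasDerivWithinAt (fun r => ∫ s in (0 : ℝ)..r, g s) (g t) (Ici t) t :=
  intervalIntegral.integral_hasDerivWithinAt_right
    ((hg.mono (by rw [uIcc_of_le ht]; exact Icc_subset_Ici_self)).intervalIntegrable)
    (t := Ioi t) ((hg.mono (Ioi_subset_Ici ht)).stronglyMeasurableAtFilter_nhdsWithin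
      measurableSet_Ioi t)
    ((hg t ht).mono (Ioi_subset_Ici ht))

/-! ### Integral formulas for the derivatives of `F t` -/

namespace IsContinuousSemigroup

open Metric Set

variable {F : ℝ → ℂ → ℂ} {f : ℂ → ℂ}

theorem isHoloFamily (hF : IsContinuousSemigroup F) : IsHoloFamily F :=
  ⟨hF.holo, hF.continuousOn_uncurry⟩

theorem isHoloFamily_comp (hF : IsContinuousSemigroup F) (hf : DifferentiableOn ℂ f (ball 0 1)) :
    IsHoloFamily (fun s z => f (F s z)) :=
  hF.isHoloFamily.const_comp hF.mapsTo hf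

theorem deriv_comp (hF : IsContinuousSemigroup F) (hf : DifferentiableOn ℂ f (ball 0 1)) {t : ℝ}
    (ht : 0 ≤ t) {z : ℂ} (hz : z ∈ ball (0 : ℂ) 1) :
    deriv (fun w => f (F t w)) z = deriv f (F t z) * deriv (F t) z :=
  (((hf.differentiableAt (isOpen_ball.mem_nhds (hF.mapsTo t ht hz))).hasDerivAt).comp z
    (hF.isHoloFamily.hasDerivAt ht hz)).deriv

/-- The generator supplies only right derivatives in time; for a continuous function with integrable
right derivative this suffices for the fundamental theorem of calculus. -/
theorem eq_sub_integral (hF : IsContinuousSemigroup F) (hf : IsGenerator f F) {t : ℝ}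
    (ht : 0 ≤ t) {z : ℂ} (hz : z ∈ ball (0 : ℂ) 1) :
    F t z = z - ∫ s in (0 : ℝ)..t, f (F s z) := by
  have := intervalIntegral.integral_eq_sub_of_hasDeriv_right_of_le ht
    ((hF.continuousOn_time hz).mono Icc_subset_Ici_self)
    (fun s hs => (hF.hasDerivWithinAt hf hs.1.le hz).mono Ioi_subset_Ici_self)
    ((hF.isHoloFamily_comp hf.holo).intervalIntegrable hz ht).neg
  rw [hF.zero_apply hz] at this
  have h2 : ∫ s in (0 : ℝ)..t, -f (F s z) = -∫ s in (0 : ℝ)..t, f (F s z) :=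
    intervalIntegral.integral_neg
  linear_combination h2 - this

theorem deriv_eq_sub_integral (hF : IsContinuousSemigroup F) (hf : IsGenerator f F) {t : ℝ}
    (ht : 0 ≤ t) {z : ℂ} (hz : z ∈ ball (0 : ℂ) 1) :
    deriv (F t) z = 1 - ∫ s in (0 : ℝ)..t, deriv f (F s z) * deriv (F s) z := by
  have h1 : F t =ᶠ[𝓝 z] fun w => w - ∫ s in (0 : ℝ)..t, f (F s w) := by
    filter_upwards [isOpen_ball.mem_nhds hz] with w hw using hF.eq_sub_integral hf ht hw
  rw [h1.deriv_eq, ((hasDerivAt_id' z).fun_sub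
    ((hF.isHoloFamily_comp hf.holo).hasDerivAt_integral ht hz)).deriv]
  congr 1
  refine intervalIntegral.integral_congr fun s hs => ?_
  rw [uIcc_of_le ht] at hs
  exact hF.deriv_comp hf.holo hs.1 hz

theorem hasDerivWithinAt_deriv (hF : IsContinuousSemigroup F) (hf : IsGenerator f F) {t : ℝ}
    (ht : 0 ≤ t) {z : ℂ} (hz : z ∈ ball (0 : ℂ) 1) :
    HasDerivWithinAt (fun s => deriv (F s) z) (-(deriv f (F t z) * deriv (F t) z)) (Ici t) t := by
  have hf' := hf.holo.deriv isOpen_ball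
  have := (hasDerivWithinAt_integral_of_continuousOn
    (((hF.isHoloFamily_comp hf').mul hF.isHoloFamily.deriv).continuousOn_time hz) ht).const_sub 1
  exact this.congr (fun s hs => hF.deriv_eq_sub_integral hf (ht.trans hs) hz)
    (hF.deriv_eq_sub_integral hf ht hz)

/-- `s ↦ deriv (F s) z` solves `y' = -f'(F s z) y`, `y 0 = 1`, so its product with the integrating
factor has right derivative zero and is constant. -/
theorem deriv_eq_exp (hF : IsContinuousSemigroup F) (hf : IsGenerator f F) {t : ℝ}
    (ht : 0 ≤ t) {z : ℂ} (hz : z ∈ ball (0 : ℂ) 1) :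
    deriv (F t) z = Complex.exp (-∫ s in (0 : ℝ)..t, deriv f (F s z)) := by
  have hf' := hf.holo.deriv isOpen_ball
  have hI : ∀ s, 0 ≤ s → HasDerivWithinAt (fun r => ∫ s in (0 : ℝ)..r, deriv f (F s z))
      (deriv f (F s z)) (Ici s) s := fun s hs =>
    hasDerivWithinAt_integral_of_continuousOn ((hF.isHoloFamily_comp hf').continuousOn_time hz) hs
  have hcI : ContinuousOn (fun r => ∫ s in (0 : ℝ)..r, deriv f (F s z)) (Icc 0 t) := by
    have := intervalIntegral.continuousOn_primitive_interval (μ := MeasureTheory.volume)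
      (f := fun s => deriv f (F s z)) (a := 0) (b := t)
    rw [uIcc_of_le ht] at this
    exact this (((hF.isHoloFamily_comp hf').continuousOn_time hz).mono
      Icc_subset_Ici_self).integrableOn_Icc
  have hc := constant_of_has_deriv_right_zero (a := 0) (b := t)
    (f := fun r => deriv (F r) z * Complex.exp (∫ s in (0 : ℝ)..r, deriv f (F s z)))
    (((hF.isHoloFamily.deriv.continuousOn_time hz).mono Icc_subset_Ici_self).mul hcI.cexp)
    (fun s hs => by
      refine ((hF.hasDerivWithinAt_deriv hf hs.1 hz).mul (hI s hs.1).cexp).congr_deriv ?_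
      ring) t ⟨ht, le_rfl⟩
  have h0 : deriv (F 0) z = 1 := by simpa using hF.deriv_eq_sub_integral hf le_rfl hz
  simp only [h0, intervalIntegral.integral_same, Complex.exp_zero, mul_one] at hc
  rw [Complex.exp_neg]
  exact eq_inv_of_mul_eq_one_left hc

theorem deriv_deriv_eq (hF : IsContinuousSemigroup F) (hf : IsGenerator f F) {t : ℝ}
    (ht : 0 ≤ t) {z : ℂ} (hz : z ∈ ball (0 : ℂ) 1) :
    deriv (deriv (F t)) z = deriv (F t) z *
      -∫ s in (0 : ℝ)..t, deriv (deriv f) (F s z) * deriv (F s) z := by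
  have hf' := hf.holo.deriv isOpen_ball
  have h1 : deriv (F t) =ᶠ[𝓝 z] fun w => Complex.exp (-∫ s in (0 : ℝ)..t, deriv f (F s w)) := by
    filter_upwards [isOpen_ball.mem_nhds hz] with w hw using hF.deriv_eq_exp hf ht hw
  rw [h1.deriv_eq, ((hF.isHoloFamily_comp hf').hasDerivAt_integral ht hz).fun_neg.cexp.deriv,
    ← hF.deriv_eq_exp hf ht hz]
  congr 2
  refine intervalIntegral.integral_congr fun s hs => ?_
  rw [uIcc_of_le ht] at hs
  exact hF.deriv_comp hf' hs.1 hz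

theorem deriv_deriv_deriv_eq (hF : IsContinuousSemigroup F) (hf : IsGenerator f F) {t : ℝ}
    (ht : 0 ≤ t) {z : ℂ} (hz : z ∈ ball (0 : ℂ) 1) :
    deriv (deriv (deriv (F t))) z =
      deriv (deriv (F t)) z * (-∫ s in (0 : ℝ)..t, deriv (deriv f) (F s z) * deriv (F s) z) +
      deriv (F t) z * -∫ s in (0 : ℝ)..t,
        (deriv (deriv (deriv f)) (F s z) * deriv (F s) z * deriv (F s) z +
          deriv (deriv f) (F s z) * deriv (deriv (F s)) z) := by
  have hf' := (hf.holo.deriv isOpen_ball).deriv isOpen_ball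
  have h1 : deriv (deriv (F t)) =ᶠ[𝓝 z] fun w => deriv (F t) w *
      -∫ s in (0 : ℝ)..t, deriv (deriv f) (F s w) * deriv (F s) w := by
    filter_upwards [isOpen_ball.mem_nhds hz] with w hw using hF.deriv_deriv_eq hf ht hw
  have hfam := (hF.isHoloFamily_comp hf').mul hF.isHoloFamily.deriv
  rw [h1.deriv_eq, ((hF.isHoloFamily.deriv.hasDerivAt ht hz).fun_mul
    (hfam.hasDerivAt_integral ht hz).fun_neg).deriv]
  congr 3
  refine intervalIntegral.integral_congr fun s hs => ?_
  rw [uIcc_of_le ht] at hs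
  refine Eq.trans ((((hF.isHoloFamily_comp hf').hasDerivAt hs.1 hz).fun_mul
    (hF.isHoloFamily.deriv.hasDerivAt hs.1 hz)).deriv) ?_
  rw [hF.deriv_comp hf' hs.1 hz]

end IsContinuousSemigroup

/-! ### Geometry of Stolz angles and limits inside them -/

section StolzAngle

open Metric Set

variable {τ : ℂ} {θ : ℝ}

theorem one_sub_conj_mul_re_pos (hτ : ‖τ‖ = 1) {z : ℂ} (hz : ‖z‖ < 1) :
    0 < (1 - (starRingEnd ℂ) τ * z).re := by
  have h1 := Complex.re_le_norm ((starRingEnd ℂ) τ * z)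
  rw [norm_mul, Complex.norm_conj, hτ, one_mul] at h1
  rw [Complex.sub_re, Complex.one_re]
  linarith

theorem conj_mul_self_of_norm_eq_one (hτ : ‖τ‖ = 1) : (starRingEnd ℂ) τ * τ = 1 := by
  rw [mul_comm, Complex.mul_conj, Complex.normSq_eq_norm_sq, hτ]; simp

theorem norm_one_sub_conj_mul (hτ : ‖τ‖ = 1) (z : ℂ) :
    ‖1 - (starRingEnd ℂ) τ * z‖ = ‖z - τ‖ := by
  rw [← conj_mul_self_of_norm_eq_one hτ, ← mul_sub, norm_mul, Complex.norm_conj, hτ, one_mul,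
    norm_sub_rev]

/-- The real part is positive in the disk and `tan` increases on `(-π/2, π/2)`. In this form the
angle is cut out by real-linear inequalities, which shows its convexity. -/
theorem mem_stolzAngle_iff (hτ : ‖τ‖ = 1) (h0 : 0 < θ) (h1 : θ < Real.pi / 2) {z : ℂ} :
    z ∈ stolzAngle τ θ ↔ ‖z‖ < 1 ∧ |(1 - (starRingEnd ℂ) τ * z).im| <
      Real.tan θ * (1 - (starRingEnd ℂ) τ * z).re := by
  refine and_congr_right fun hz => ?_
  have hre := one_sub_conj_mul_re_pos hτ hz
  set u := 1 - (starRingEnd ℂ) τ * z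
  have harg : |Complex.arg u| < Real.pi / 2 := Complex.abs_arg_lt_pi_div_two_iff.2 (Or.inl hre)
  have htan : Real.tan |Complex.arg u| = |u.im| / u.re := by
    conv_rhs => rw [← abs_of_pos hre, ← abs_div, ← Complex.tan_arg]
    rcases le_total 0 (Complex.arg u) with h | h
    · rw [abs_of_nonneg h, abs_of_nonneg (Real.tan_nonneg_of_nonneg_of_le_pi_div_two h
        ((le_abs_self _).trans harg.le))]
    · rw [abs_of_nonpos h, Real.tan_neg, abs_of_nonpos (Real.tan_nonpos_of_nonpos_of_neg_pi_div_two_le h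
        (by linarith [neg_abs_le (Complex.arg u)]))]
  rw [← div_lt_iff₀ hre, ← htan]
  have hpi := Real.pi_pos
  exact (Real.strictMonoOn_tan.lt_iff_lt
    ⟨by linarith [abs_nonneg (Complex.arg u)], harg⟩ ⟨by linarith, h1⟩).symm

theorem convex_stolzAngle (hτ : ‖τ‖ = 1) (h0 : 0 < θ) (h1 : θ < Real.pi / 2) :
    Convex ℝ (stolzAngle τ θ) := by
  intro z hz w hw a b ha hb hab
  rw [mem_stolzAngle_iff hτ h0 h1] at hz hw ⊢
  have hball := convex_ball (0 : ℂ) 1 (mem_ball_zero_iff.2 hz.1) (mem_ball_zero_iff.2 hw.1) ha hb hab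
  refine ⟨mem_ball_zero_iff.1 hball, ?_⟩
  have e : 1 - (starRingEnd ℂ) τ * (a • z + b • w) =
      a • (1 - (starRingEnd ℂ) τ * z) + b • (1 - (starRingEnd ℂ) τ * w) := by
    simp only [Complex.real_smul]
    have : (a : ℂ) + b = 1 := by exact_mod_cast hab
    linear_combination -this
  rw [e, Complex.add_im, Complex.add_re, Complex.smul_im, Complex.smul_im, Complex.smul_re,
    Complex.smul_re, smul_eq_mul, smul_eq_mul, smul_eq_mul, smul_eq_mul]
  obtain ⟨-, hz⟩ := hz
  obtain ⟨-, hw⟩ := hw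
  rw [abs_lt] at hz hw ⊢
  rcases ha.eq_or_lt with rfl | ha
  · obtain rfl : b = 1 := by linarith
    constructor <;> linarith [hw.1, hw.2]
  · constructor
    · nlinarith [mul_lt_mul_of_pos_left hz.1 ha, mul_le_mul_of_nonneg_left hw.1.le hb]
    · nlinarith [mul_lt_mul_of_pos_left hz.2 ha, mul_le_mul_of_nonneg_left hw.2.le hb]

theorem stolzAngle_subset_ball : stolzAngle τ θ ⊆ ball 0 1 :=
  fun _ hz => mem_ball_zero_iff.2 hz.1

theorem ofReal_mul_mem_stolzAngle (hτ : ‖τ‖ = 1) (h0 : 0 < θ) {r : ℝ} (hr0 : 0 < r) (hr1 : r < 1) :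
    (r : ℂ) * τ ∈ stolzAngle τ θ := by
  refine ⟨by rw [norm_mul, hτ, Complex.norm_real, mul_one, Real.norm_of_nonneg hr0.le]; exact hr1, ?_⟩
  have : 1 - (starRingEnd ℂ) τ * (r * τ) = ((1 - r : ℝ) : ℂ) := by
    push_cast
    linear_combination -(r : ℂ) * conj_mul_self_of_norm_eq_one hτ
  rw [this, Complex.arg_ofReal_of_nonneg (by linarith), abs_zero]
  exact h0

theorem tendsto_ofReal_mul_stolzAngle (hτ : ‖τ‖ = 1) (h0 : 0 < θ) :
    Tendsto (fun r : ℝ => (r : ℂ) * τ) (𝓝[<] 1) (𝓝[stolzAngle τ θ] τ) := by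
  refine tendsto_nhdsWithin_of_tendsto_nhds_of_eventually_within _ ?_ ?_
  · have : Tendsto (fun r : ℝ => (r : ℂ) * τ) (𝓝 1) (𝓝 (((1 : ℝ) : ℂ) * τ)) :=
      (Complex.continuous_ofReal.mul continuous_const).tendsto 1
    rw [Complex.ofReal_one, one_mul] at this
    exact this.mono_left inf_le_left
  · filter_upwards [Ioo_mem_nhdsLT zero_lt_one] with r hr
    exact ofReal_mul_mem_stolzAngle hτ h0 hr.1 hr.2

theorem nhdsWithin_stolzAngle_neBot (hτ : ‖τ‖ = 1) (h0 : 0 < θ) : (𝓝[stolzAngle τ θ] τ).NeBot :=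
  (tendsto_ofReal_mul_stolzAngle hτ h0).neBot

/-- If the derivative of `h` tends to `β` in a Stolz angle at `τ` and `h` tends to `0` radially,
then `h` is differentiable at `τ` relative to this Stolz angle. -/
theorem eventually_norm_sub_le_of_tendsto_deriv (hτ : ‖τ‖ = 1) (h0 : 0 < θ) (h1 : θ < Real.pi / 2)
    {h : ℂ → ℂ} (hd : DifferentiableOn ℂ h (ball 0 1)) {β : ℂ}
    (hβ : Tendsto (deriv h) (𝓝[stolzAngle τ θ] τ) (𝓝 β))
    (hr : Tendsto (fun r : ℝ => h ((r : ℂ) * τ)) (𝓝[<] 1) (𝓝 0)) {η : ℝ} (hη : 0 < η) :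
    ∀ᶠ z in 𝓝[stolzAngle τ θ] τ, ‖h z - β * (z - τ)‖ ≤ η * ‖z - τ‖ := by
  obtain ⟨ε, hε, hsub⟩ := Metric.mem_nhdsWithin_iff.1 (hβ (closedBall_mem_nhds β hη))
  rw [eventually_iff, Metric.mem_nhdsWithin_iff]
  refine ⟨ε, hε, fun z hz => ?_⟩
  have hconv := (convex_ball τ ε).inter (convex_stolzAngle hτ h0 h1)
  -- On this convex set `h x - β x` has derivative of norm at most `η`. Taking `w = r τ` and letting
  -- `r → 1⁻` turns the Lipschitz bound into the claim.
  have hlip : ∀ w ∈ ball τ ε ∩ stolzAngle τ θ,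
      ‖(h z - β * z) - (h w - β * w)‖ ≤ η * ‖z - w‖ := by
    intro w hw
    refine hconv.norm_image_sub_le_of_norm_hasDerivWithin_le (f := fun x => h x - β * x)
      (f' := fun x => deriv h x - β) (fun x hx => ?_) (fun x hx => ?_) hw hz
    · have := ((hd.differentiableAt
        (isOpen_ball.mem_nhds (stolzAngle_subset_ball hx.2))).hasDerivAt).sub
        ((hasDerivAt_id x).const_mul β)
      rw [mul_one] at this
      exact this.hasDerivWithinAt
    · simpa [dist_eq_norm] using hsub hx
  have ht := tendsto_ofReal_mul_stolzAngle hτ h0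
  have ht' : Tendsto (fun r : ℝ => (r : ℂ) * τ) (𝓝[<] 1) (𝓝 τ) := ht.mono_right inf_le_left
  have key := le_of_tendsto_of_tendsto
    (((tendsto_const_nhds (x := h z - β * z)).sub (hr.sub (ht'.const_mul β))).norm)
    (((tendsto_const_nhds (x := z)).sub ht').norm.const_mul η)
    (by
      filter_upwards [ht (inter_mem (mem_nhdsWithin_of_mem_nhds (ball_mem_nhds τ hε))
        self_mem_nhdsWithin)] with r hr
      exact hlip _ hr)
  have e : h z - β * (z - τ) = h z - β * z - (0 - β * τ) := by ring
  rw [mem_ofPred_eq, e]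
  exact key

/-- A bounded derivative makes `h` Lipschitz on the convex set near `τ`, hence uniformly continuous
there, so it maps the Cauchy filter at `τ` to a convergent one. -/
theorem exists_tendsto_of_tendsto_deriv (hτ : ‖τ‖ = 1) (h0 : 0 < θ) (h1 : θ < Real.pi / 2)
    {h : ℂ → ℂ} (hd : DifferentiableOn ℂ h (ball 0 1)) {α : ℂ}
    (hα : Tendsto (deriv h) (𝓝[stolzAngle τ θ] τ) (𝓝 α)) :
    ∃ β, Tendsto h (𝓝[stolzAngle τ θ] τ) (𝓝 β) := by
  have := nhdsWithin_stolzAngle_neBot hτ h0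
  obtain ⟨ε, hε, hsub⟩ := Metric.mem_nhdsWithin_iff.1 (hα (closedBall_mem_nhds α one_pos))
  have hconv := (convex_ball τ ε).inter (convex_stolzAngle hτ h0 h1)
  have hlip : LipschitzOnWith (‖α‖₊ + 1) h (ball τ ε ∩ stolzAngle τ θ) := by
    refine hconv.lipschitzOnWith_of_nnnorm_hasDerivWithin_le (f' := deriv h)
      (fun x hx => ?_) (fun x hx => ?_)
    · exact ((hd.differentiableAt
        (isOpen_ball.mem_nhds (stolzAngle_subset_ball hx.2))).hasDerivAt).hasDerivWithinAt
    · have := hsub hx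
      rw [mem_preimage, mem_closedBall, dist_eq_norm] at this
      rw [← NNReal.coe_le_coe]
      push_cast
      linarith [norm_le_norm_add_norm_sub' (deriv h x) α]
  have hmem : ball τ ε ∩ stolzAngle τ θ ∈ 𝓝[stolzAngle τ θ] τ :=
    inter_mem (mem_nhdsWithin_of_mem_nhds (ball_mem_nhds τ hε)) self_mem_nhdsWithin
  have hc : Cauchy (𝓝[stolzAngle τ θ] τ) := cauchy_nhds.mono inf_le_left
  obtain ⟨β, hβ⟩ := CompleteSpace.complete
    (hc.map_of_le hlip.uniformContinuousOn (le_principal_iff.2 hmem))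
  exact ⟨β, hβ⟩

/-- Each Stolz angle has its own limit; all of them agree because every Stolz angle contains the
radius to `τ`. -/
theorem HasAngularLimit.exists_of_deriv (hτ : ‖τ‖ = 1) {h : ℂ → ℂ}
    (hd : DifferentiableOn ℂ h (ball 0 1)) {α : ℂ} (hα : HasAngularLimit (deriv h) τ α) :
    ∃ β, HasAngularLimit h τ β := by
  have hpi := Real.pi_pos
  obtain ⟨β, hβ⟩ := exists_tendsto_of_tendsto_deriv hτ (by positivity : 0 < Real.pi / 4)
    (by linarith) hd (hα _ (by positivity) (by linarith))
  refine ⟨β, fun θ h0 h1 => ?_⟩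
  obtain ⟨β', hβ'⟩ := exists_tendsto_of_tendsto_deriv hτ h0 h1 hd (hα _ h0 h1)
  have h2 := hβ.comp (tendsto_ofReal_mul_stolzAngle hτ (by positivity))
  have h3 := hβ'.comp (tendsto_ofReal_mul_stolzAngle hτ h0)
  rwa [tendsto_nhds_unique h2 h3]

end StolzAngle

/-! ### Reality of `β` and confinement of trajectories -/

section Generator

open Metric Set

variable {F : ℝ → ℂ → ℂ} {f : ℂ → ℂ} {τ β : ℂ}

/-- A nonnegative function vanishing at `a` has nonnegative right derivative there. -/
theorem HasDerivWithinAt.nonneg_of_forall_le {φ : ℝ → ℝ} {φ' a : ℝ}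
    (h : HasDerivWithinAt φ φ' (Ici a) a) (h0 : ∀ t, a ≤ t → φ a ≤ φ t) : 0 ≤ φ' := by
  rw [← hasDerivWithinAt_Ioi_iff_Ici, hasDerivWithinAt_iff_tendsto_slope' (by simp)] at h
  refine ge_of_tendsto h ?_
  filter_upwards [self_mem_nhdsWithin] with t ht
  rw [slope_def_field]
  exact div_nonneg (sub_nonneg.2 (h0 t (le_of_lt ht))) (sub_nonneg.2 (le_of_lt ht))

/-- The infinitesimal form of the Schwarz–Pick inequality for generators. -/
theorem IsGenerator.re_nonneg (hF : IsContinuousSemigroup F) (hf : IsGenerator f F) {z : ℂ}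
    (hz : z ∈ ball (0 : ℂ) 1) :
    0 ≤ (deriv f z).re * (1 - ‖z‖ ^ 2) + 2 * ((starRingEnd ℂ) z * f z).re := by
  have hF0 := hF.zero_apply hz
  have hF1 : deriv (F 0) z = 1 := by simpa using hF.deriv_eq_sub_integral hf le_rfl hz
  have h1 := (hF.hasDerivWithinAt hf le_rfl hz).norm_sq
  have h2 : HasDerivWithinAt (fun s => (deriv (F s) z).re) (-(deriv f z).re) (Ici 0) 0 := by
    have := Complex.reCLM.hasFDerivAt.comp_hasDerivWithinAt 0 (hF.hasDerivWithinAt_deriv hf le_rfl hz)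
    simpa [hF0, hF1, Function.comp_def] using this
  -- `1 - |F s z|² - Re (F s)'(z) (1 - |z|²)` is nonnegative by Schwarz–Pick and vanishes at `s =
  -- 0`; its right derivative there is the quantity to be bounded.
  have h3 := (h1.const_sub 1).sub (h2.mul_const (1 - ‖z‖ ^ 2))
  have h4 := h3.nonneg_of_forall_le (fun t ht => by
    have hp : 0 ≤ 1 - ‖z‖ ^ 2 := by
      have : ‖z‖ < 1 := by simpa using hz
      nlinarith [norm_nonneg z]
    have := norm_deriv_mul_le_of_mapsTo_unit_ball (hF.holo t ht) (hF.mapsTo t ht) hz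
    have h5 := mul_le_mul_of_nonneg_right (Complex.re_le_norm (deriv (F t) z)) hp
    simp only [hF0, hF1, Pi.sub_apply, Complex.one_re]
    linarith)
  rw [hF0, Complex.inner] at h4
  simp only [mul_neg, Complex.neg_re, neg_mul] at h4
  have h6 : (f z * (starRingEnd ℂ) z).re = ((starRingEnd ℂ) z * f z).re := by rw [mul_comm]
  simp at h4 ⊢
  linarith

/-- Along `z = τ(1 - δ(1 + iσ))`, with `σ = ±1`, divide the infinitesimal Schwarz–Pick inequality by
`δ`. As `1 - |z|² = 2δ - 2δ²` and `f(z)/δ → -βτ(1 + iσ)`, the limit is `2 Re β - 2 Re (β(1 + iσ)) =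
2σ Im β`. The path makes angle `π/4` with the radius, so it fits in the Stolz angle `π/3`. -/
theorem IsGenerator.mul_im_nonneg (hF : IsContinuousSemigroup F) (hf : IsGenerator f F)
    (hτ : IsBoundaryNullPoint f τ) (hβ : HasAngularLimit (deriv f) τ β) {σ : ℝ} (hσ : σ ^ 2 = 1) :
    0 ≤ σ * β.im := by
  have hpi := Real.pi_pos
  have h0 : 0 < Real.pi / 3 := by positivity
  have h1 : Real.pi / 3 < Real.pi / 2 := by linarith
  have hττ := conj_mul_self_of_norm_eq_one hτ.1
  set c : ℂ := ⟨1, σ⟩ with hc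
  set z : ℝ → ℂ := fun δ => τ * (1 - δ * c) with hzdef
  have hnorm : ∀ δ : ℝ, ‖z δ‖ ^ 2 = 1 - δ * (2 - 2 * δ) := by
    intro δ
    rw [hzdef, norm_mul, hτ.1, one_mul, Complex.sq_norm, Complex.normSq_apply]
    simp [hc]
    linear_combination δ ^ 2 * hσ
  have hu : ∀ δ : ℝ, 1 - (starRingEnd ℂ) τ * z δ = δ * c := by
    intro δ
    simp only [hzdef]
    linear_combination (-1 + δ * c) * hττ
  have hσ1 : |σ| = 1 := (pow_eq_one_iff_of_nonneg (abs_nonneg σ) two_ne_zero).1 (by rwa [sq_abs])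
  have hmem : ∀ δ : ℝ, 0 < δ → δ < 1 → z δ ∈ stolzAngle τ (Real.pi / 3) := by
    intro δ hδ hδ1
    refine (mem_stolzAngle_iff hτ.1 h0 h1).2 ⟨?_, ?_⟩
    · have := hnorm δ
      have h3 : 0 < δ * (2 - 2 * δ) := mul_pos hδ (by linarith)
      nlinarith [norm_nonneg (z δ)]
    · rw [hu, Real.tan_pi_div_three]
      simp only [hc, Complex.re_ofReal_mul, Complex.im_ofReal_mul, abs_mul, hσ1, abs_of_pos hδ]
      have : 1 < √3 := by rw [Real.lt_sqrt] <;> norm_num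
      nlinarith
  have hz : Tendsto z (𝓝[>] 0) (𝓝[stolzAngle τ (Real.pi / 3)] τ) := by
    refine tendsto_nhdsWithin_of_tendsto_nhds_of_eventually_within _ ?_ ?_
    · have hcz : Continuous z := by fun_prop
      have := hcz.tendsto 0
      simp only [hzdef, Complex.ofReal_zero, zero_mul, sub_zero, mul_one] at this
      exact this.mono_left inf_le_left
    · filter_upwards [Ioo_mem_nhdsGT zero_lt_one] with δ hδ using hmem δ hδ.1 hδ.2
  have hzn : Tendsto z (𝓝[>] 0) (𝓝 τ) := hz.mono_right inf_le_left
  have hf' : Tendsto (fun δ => deriv f (z δ)) (𝓝[>] 0) (𝓝 β) := (hβ _ h0 h1).comp hz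
  have hsub : ∀ δ : ℝ, z δ - τ = -(δ * (τ * c)) := fun δ => by simp only [hzdef]; ring
  have hfd : Tendsto (fun δ : ℝ => f (z δ) / δ) (𝓝[>] 0) (𝓝 (-(β * (τ * c)))) := by
    rw [Metric.tendsto_nhds]
    intro ε hε
    have hη : 0 < ε / (‖c‖ + 1) := by positivity
    filter_upwards [hz.eventually (eventually_norm_sub_le_of_tendsto_deriv hτ.1 h0 h1 hf.holo
      (hβ _ h0 h1) hτ.2 hη), self_mem_nhdsWithin] with δ hδ hδ0
    have hδ0 : 0 < δ := hδ0
    have hδc : (δ : ℂ) ≠ 0 := by exact_mod_cast hδ0.ne'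
    rw [hsub, norm_neg, norm_mul, norm_mul, hτ.1, one_mul, Complex.norm_real,
      Real.norm_of_nonneg hδ0.le] at hδ
    have e : f (z δ) / δ - -(β * (τ * c)) = (f (z δ) - β * -(δ * (τ * c))) / δ := by
      field_simp
    rw [dist_eq_norm, e, norm_div, Complex.norm_real, Real.norm_of_nonneg hδ0.le, div_lt_iff₀ hδ0]
    refine hδ.trans_lt ?_
    rw [div_mul_eq_mul_div, div_lt_iff₀ (by positivity)]
    nlinarith [mul_pos hε hδ0]
  have hone : Tendsto (fun δ : ℝ => 2 - 2 * δ) (𝓝[>] 0) (𝓝 2) := by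
    have h : Continuous (fun δ : ℝ => 2 - 2 * δ) := by fun_prop
    have := h.tendsto 0
    simp only [mul_zero, sub_zero] at this
    exact this.mono_left inf_le_left
  have hlim := (((Complex.continuous_re.tendsto _).comp hf').mul hone).add
    (((Complex.continuous_re.tendsto _).comp
      (((Complex.continuous_conj.tendsto _).comp hzn).mul hfd)).const_mul 2)
  have key := ge_of_tendsto hlim (b := 0) (by
    filter_upwards [Ioo_mem_nhdsGT zero_lt_one] with δ hδ
    have h := hf.re_nonneg hF (stolzAngle_subset_ball (hmem δ hδ.1 hδ.2))
    rw [hnorm] at h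
    have e : (starRingEnd ℂ) (z δ) * (f (z δ) / δ) = ((starRingEnd ℂ) (z δ) * f (z δ)) / δ := by ring
    simp only [Function.comp_apply]
    rw [e, Complex.div_ofReal_re]
    have e2 : (deriv f (z δ)).re * (2 - 2 * δ) + 2 * (((starRingEnd ℂ) (z δ) * f (z δ)).re / δ) =
      ((deriv f (z δ)).re * (1 - (1 - δ * (2 - 2 * δ))) +
        2 * ((starRingEnd ℂ) (z δ) * f (z δ)).re) / δ := by
      have := hδ.1.ne'
      field_simp
      ring
    rw [e2]
    exact div_nonneg h hδ.1.le)
  have e3 : (starRingEnd ℂ) τ * -(β * (τ * c)) = -(β * c) := by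
    linear_combination -(β * c) * hττ
  rw [e3] at key
  simp [hc] at key
  linarith

/-- The angular derivative of a generator at a boundary null point is real. -/
theorem IsGenerator.im_eq_zero (hF : IsContinuousSemigroup F) (hf : IsGenerator f F)
    (hτ : IsBoundaryNullPoint f τ) (hβ : HasAngularLimit (deriv f) τ β) : β.im = 0 := by
  have h1 := hf.mul_im_nonneg hF hτ hβ (σ := 1) (by norm_num)
  have h2 := hf.mul_im_nonneg hF hτ hβ (σ := -1) (by norm_num)
  linarith

/-- Trajectories starting close to `τ` inside a Stolz angle remain, for a bounded time, close to
`τ` inside any larger Stolz angle. -/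
theorem IsContinuousSemigroup.eventually_mem_stolzAngle (hF : IsContinuousSemigroup F)
    (hf : IsGenerator f F) (hτ : IsBoundaryNullPoint f τ)
    (hβ : HasAngularLimit (deriv f) τ β) {θ θ' : ℝ} (h0 : 0 < θ) (hθ : θ < θ')
    (h1 : θ' < Real.pi / 2) {T : ℝ} (hT : 0 ≤ T) {ε : ℝ} (hε : 0 < ε) :
    ∀ᶠ z in 𝓝[stolzAngle τ θ] τ, ∀ s ∈ Icc 0 T, F s z ∈ ball τ ε ∩ stolzAngle τ θ' := by
  have him := hf.im_eq_zero hF hτ hβ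
  -- `η` bounds the speed at which the argument drifts, so over time `T` the drift stays below `θ' -
  -- θ`. The estimate on `f` below uses `η / 2`, to leave a strict inequality for the barrier
  -- argument.
  obtain ⟨η, hη, hηT⟩ : ∃ η : ℝ, 0 < η ∧ η * T < θ' - θ :=
    ⟨(θ' - θ) / (T + 1), div_pos (by linarith) (by linarith), by
      rw [div_mul_eq_mul_div, div_lt_iff₀ (by linarith)]; nlinarith⟩
  obtain ⟨ε₁, hε₁, hsub⟩ := Metric.mem_nhdsWithin_iff.1 (eventually_norm_sub_le_of_tendsto_deriv
    hτ.1 (h0.trans hθ) h1 hf.holo (hβ _ (h0.trans hθ) h1) hτ.2 (half_pos hη))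
  set ε₂ := min ε ε₁ with hε₂def
  have hε₂ : 0 < ε₂ := lt_min hε hε₁
  -- `log ‖u‖` grows by at most `M` up to time `T`, so starting within `ε₂ * exp (-M)` of `τ` keeps
  -- the trajectory within `ε₂`.
  set M := (‖β‖ + η) * T with hM
  filter_upwards [self_mem_nhdsWithin, mem_nhdsWithin_of_mem_nhds
    (ball_mem_nhds τ (mul_pos hε₂ (Real.exp_pos (-M))))] with z hz hzτ
  have hz𝔻 := stolzAngle_subset_ball hz
  set u : ℝ → ℂ := fun s => 1 - (starRingEnd ℂ) τ * F s z with hu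
  have hF1 : ∀ s, 0 ≤ s → ‖F s z‖ < 1 := fun s hs => by simpa using hF.mapsTo s hs hz𝔻
  have hre : ∀ s, 0 ≤ s → 0 < (u s).re := fun s hs => one_sub_conj_mul_re_pos hτ.1 (hF1 s hs)
  have hune : ∀ s, 0 ≤ s → u s ≠ 0 := fun s hs h => by simpa [h] using hre s hs
  have hunorm : ∀ s, ‖u s‖ = ‖F s z - τ‖ := fun s => norm_one_sub_conj_mul hτ.1 _
  have hslit : ∀ s, 0 ≤ s → u s ∈ Complex.slitPlane := fun s hs => Or.inl (hre s hs)
  -- The deviation of `log u` from the solution `log (u 0) - β s` of the linearised equation.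
  set g : ℝ → ℂ := fun s => Complex.log (u s) - Complex.log (u 0) + β * s with hg
  -- The real part of `g` controls the distance to `τ`; the imaginary part is exactly the change of
  -- argument, because `β.im = 0`.
  have hregion : ∀ s ∈ Icc 0 T, ‖g s‖ ≤ η * s → F s z ∈ ball τ ε₂ ∩ stolzAngle τ θ' := by
    intro s hs hgs
    have hηs : η * s ≤ η * T := mul_le_mul_of_nonneg_left hs.2 hη.le
    refine ⟨?_, hF1 s hs.1, ?_⟩
    · have h2 : (g s).re = Real.log ‖u s‖ - Real.log ‖u 0‖ + β.re * s := by
        simp [hg, Complex.log_re]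
      have h3 := (Complex.abs_re_le_norm (g s)).trans hgs
      have h4 : Real.log ‖u s‖ ≤ Real.log ‖u 0‖ + M := by
        have h5 : -(β.re * s) ≤ ‖β‖ * T := by
          have := (abs_le.1 (Complex.abs_re_le_norm β)).1
          nlinarith [hs.1, hs.2, norm_nonneg β]
        rw [hM]
        linarith [(abs_le.1 h3).2]
      have hp : 0 < ‖u 0‖ := norm_pos_iff.2 (hune 0 le_rfl)
      have h6 : ‖u s‖ ≤ ‖u 0‖ * Real.exp M := by
        rw [← Real.exp_log (norm_pos_iff.2 (hune s hs.1)), ← Real.exp_log hp, ← Real.exp_add]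
        exact Real.exp_le_exp.2 (by simpa using h4)
      rw [mem_ball, dist_eq_norm, ← hunorm]
      have h7 : ‖u 0‖ < ε₂ * Real.exp (-M) := by
        rw [hunorm, hF.zero_apply hz𝔻, ← dist_eq_norm]; exact hzτ
      calc ‖u s‖ ≤ ‖u 0‖ * Real.exp M := h6
        _ < ε₂ * Real.exp (-M) * Real.exp M := by gcongr
        _ = ε₂ := by rw [mul_assoc, ← Real.exp_add]; simp
    · have h2 : (g s).im = Complex.arg (u s) - Complex.arg (u 0) := by
        simp [hg, Complex.log_im, him]
      have h3 := (Complex.abs_im_le_norm (g s)).trans hgs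
      have h4 : |Complex.arg (u 0)| < θ := by
        simp only [hu, hF.zero_apply hz𝔻]; exact hz.2
      rw [h2] at h3
      calc |Complex.arg (u s)| = |(Complex.arg (u s) - Complex.arg (u 0)) + Complex.arg (u 0)| := by
            rw [sub_add_cancel]
        _ ≤ _ := abs_add_le _ _
        _ < θ' := by linarith
  have hu' : ∀ s, 0 ≤ s → HasDerivWithinAt u ((starRingEnd ℂ) τ * f (F s z)) (Ici s) s :=
    fun s hs => (((hF.hasDerivWithinAt hf hs hz𝔻).const_mul ((starRingEnd ℂ) τ)).const_sub
      1).congr_deriv (by ring)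
  have hg' : ∀ s ∈ Ico 0 T, HasDerivWithinAt g
      ((starRingEnd ℂ) τ * f (F s z) / u s + β) (Ici s) s := by
    intro s hs
    refine (((hu' s hs.1).clog_real (hslit s hs.1)).sub_const _).add ?_
    simpa using ((Complex.ofRealCLM.hasDerivAt (x := s)).const_mul β).hasDerivWithinAt
  have hgc : ContinuousOn g (Icc 0 T) := by
    have hcu : ContinuousOn u (Icc 0 T) := continuousOn_const.sub
      (continuousOn_const.mul ((hF.continuousOn_time hz𝔻).mono Icc_subset_Ici_self))
    exact ((hcu.clog (fun s hs => hslit s hs.1)).sub continuousOn_const).add (by fun_prop)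
  -- Bootstrap: at a time when `‖g s‖ = η s`, `hregion` puts the trajectory where the estimate on
  -- `f` holds, so `‖g'‖ ≤ η / 2 < η` and the barrier `η s` cannot be crossed.
  have hfence := image_norm_le_of_norm_deriv_right_lt_deriv_boundary hgc hg'
    (B := fun s => η * s) (B' := fun _ => η) (by simp [hg])
    (fun s => by simpa using (hasDerivAt_id s).const_mul η) (by
      intro s hs hgs
      have hr := hregion s ⟨hs.1, hs.2.le⟩ hgs.le
      have hs' := hsub ⟨ball_subset_ball (min_le_right _ _) hr.1, hr.2⟩
      have hup : 0 < ‖u s‖ := norm_pos_iff.2 (hune s hs.1)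
      have e : (starRingEnd ℂ) τ * f (F s z) / u s + β =
          (starRingEnd ℂ) τ * (f (F s z) - β * (F s z - τ)) / u s := by
        have h2 := hune s hs.1
        field_simp
        simp only [hu]
        linear_combination -β * conj_mul_self_of_norm_eq_one hτ.1
      rw [e, norm_div, norm_mul, Complex.norm_conj, hτ.1, one_mul, div_lt_iff₀ hup]
      have h3 : ‖f (F s z) - β * (F s z - τ)‖ ≤ η / 2 * ‖F s z - τ‖ := hs'
      rw [← hunorm] at h3
      nlinarith [mul_pos hη hup])
  intro s hs
  have := hregion s hs (hfence hs)
  exact ⟨ball_subset_ball (min_le_left _ _) this.1, this.2⟩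

end Generator

/-! ### Bounded pointwise limits -/

/-- Along the filter `l`, the functions `g s`, `0 ≤ s ≤ T`, are uniformly bounded and converge
pointwise in `s` to `L s`. -/
structure HasBddLimit (l : Filter ℂ) (T : ℝ) (g : ℝ → ℂ → ℂ) (L : ℝ → ℂ) : Prop where
  bdd : ∃ C : ℝ, ∀ᶠ z in l, ∀ s ∈ Set.Icc 0 T, ‖g s z‖ ≤ C
  tendsto : ∀ s ∈ Set.Icc 0 T, Tendsto (g s) l (𝓝 (L s))

namespace HasBddLimit

open Set

variable {l : Filter ℂ} {T : ℝ} {g g' : ℝ → ℂ → ℂ} {L L' : ℝ → ℂ}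

theorem congr (h : HasBddLimit l T g L) (hg : ∀ᶠ z in l, ∀ s ∈ Icc 0 T, g' s z = g s z) :
    HasBddLimit l T g' L where
  bdd := by
    obtain ⟨C, hC⟩ := h.bdd
    refine ⟨C, ?_⟩
    filter_upwards [hC, hg] with z h1 h2 s hs
    rw [h2 s hs]
    exact h1 s hs
  tendsto s hs := (h.tendsto s hs).congr' (by filter_upwards [hg] with z hz using (hz s hs).symm)

theorem add (h : HasBddLimit l T g L) (h' : HasBddLimit l T g' L') :
    HasBddLimit l T (fun s z => g s z + g' s z) (fun s => L s + L' s) where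
  bdd := by
    obtain ⟨C, hC⟩ := h.bdd
    obtain ⟨C', hC'⟩ := h'.bdd
    refine ⟨C + C', ?_⟩
    filter_upwards [hC, hC'] with z h1 h2 s hs
    exact (norm_add_le _ _).trans (add_le_add (h1 s hs) (h2 s hs))
  tendsto s hs := (h.tendsto s hs).add (h'.tendsto s hs)

theorem mul (h : HasBddLimit l T g L) (h' : HasBddLimit l T g' L') :
    HasBddLimit l T (fun s z => g s z * g' s z) (fun s => L s * L' s) where
  bdd := by
    obtain ⟨C, hC⟩ := h.bdd
    obtain ⟨C', hC'⟩ := h'.bdd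
    refine ⟨C * C', ?_⟩
    filter_upwards [hC, hC'] with z h1 h2 s hs
    rw [norm_mul]
    exact mul_le_mul (h1 s hs) (h2 s hs) (norm_nonneg _) ((norm_nonneg _).trans (h1 s hs))
  tendsto s hs := (h.tendsto s hs).mul (h'.tendsto s hs)

theorem neg (h : HasBddLimit l T g L) : HasBddLimit l T (fun s z => -g s z) (fun s => -L s) where
  bdd := by simpa only [norm_neg] using h.bdd
  tendsto s hs := (h.tendsto s hs).neg

theorem cexp (h : HasBddLimit l T g L) :
    HasBddLimit l T (fun s z => Complex.exp (g s z)) (fun s => Complex.exp (L s)) where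
  bdd := by
    obtain ⟨C, hC⟩ := h.bdd
    refine ⟨Real.exp C, ?_⟩
    filter_upwards [hC] with z h1 s hs
    rw [Complex.norm_exp]
    exact Real.exp_le_exp.2 ((Complex.re_le_norm _).trans (h1 s hs))
  tendsto s hs := (h.tendsto s hs).cexp

/-- Dominated convergence with a constant majorant. The bound persists for the integrals, so the
limit obtained for one derivative of `F s` can be used inside the integral for the next. -/
theorem integral [l.IsCountablyGenerated] (h : HasBddLimit l T g L)
    (hc : ∀ᶠ z in l, ContinuousOn (fun s => g s z) (Icc 0 T)) :
    HasBddLimit l T (fun t z => ∫ s in (0 : ℝ)..t, g s z) (fun t => ∫ s in (0 : ℝ)..t, L s) where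
  bdd := by
    obtain ⟨C, hC⟩ := h.bdd
    refine ⟨|C| * T, ?_⟩
    filter_upwards [hC] with z h1 t ht
    refine (intervalIntegral.norm_integral_le_of_norm_le_const (C := |C|) fun s hs => ?_).trans ?_
    · rw [uIoc_of_le ht.1] at hs
      exact (h1 s ⟨hs.1.le, hs.2.trans ht.2⟩).trans (le_abs_self C)
    · rw [sub_zero, abs_of_nonneg ht.1]
      exact mul_le_mul_of_nonneg_left ht.2 (abs_nonneg C)
  tendsto t ht := by
    obtain ⟨C, hC⟩ := h.bdd
    have hsub : uIoc 0 t ⊆ Icc 0 T := by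
      rw [uIoc_of_le ht.1]
      exact fun s hs => ⟨hs.1.le, hs.2.trans ht.2⟩
    refine intervalIntegral.tendsto_integral_filter_of_dominated_convergence (fun _ => C) ?_ ?_
      (by simp) ?_
    · filter_upwards [hc] with z hz
      exact (hz.mono hsub).aestronglyMeasurable measurableSet_uIoc
    · filter_upwards [hC] with z hz
      exact Eventually.of_forall fun s hs => hz s (hsub hs)
    · exact Eventually.of_forall fun s hs => h.tendsto s (hsub hs)

end HasBddLimit

/-! ### Passage to the limit at `τ` -/

section Limits

open Metric Set

variable {F : ℝ → ℂ → ℂ} {f : ℂ → ℂ} {τ β α γ : ℂ} {θ T : ℝ}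

/-- Trajectories from the angle `θ` are confined to a wider angle `θ' < π/2`, where `h` still has
the limit `L`; confinement uniform in `s` yields the common bound. -/
theorem IsContinuousSemigroup.hasBddLimit_comp (hF : IsContinuousSemigroup F)
    (hf : IsGenerator f F) (hτ : IsBoundaryNullPoint f τ) (hβ : HasAngularLimit (deriv f) τ β)
    (h0 : 0 < θ) (h1 : θ < Real.pi / 2) (hT : 0 ≤ T) {h : ℂ → ℂ} {L : ℂ}
    (hh : HasAngularLimit h τ L) :
    HasBddLimit (𝓝[stolzAngle τ θ] τ) T (fun s z => h (F s z)) (fun _ => L) := by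
  obtain ⟨θ', hθ, hθ'⟩ := exists_between h1
  have hlim := hh θ' (h0.trans hθ) hθ'
  have key := fun {ε : ℝ} (hε : 0 < ε) =>
    hF.eventually_mem_stolzAngle hf hτ hβ h0 hθ hθ' hT hε
  constructor
  · obtain ⟨ε, hε, hsub⟩ := Metric.mem_nhdsWithin_iff.1 (hlim (closedBall_mem_nhds L one_pos))
    refine ⟨‖L‖ + 1, ?_⟩
    filter_upwards [key hε] with z hz s hs
    have := hsub (hz s hs)
    rw [mem_preimage, mem_closedBall, dist_eq_norm] at this
    linarith [norm_le_norm_add_norm_sub' (h (F s z)) L]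
  · intro s hs
    refine hlim.comp (tendsto_nhdsWithin_iff.2 ⟨?_, ?_⟩)
    · rw [Metric.tendsto_nhds]
      intro ε hε
      filter_upwards [key hε] with z hz using (hz s hs).1
    · filter_upwards [key one_pos] with z hz using (hz s hs).2

theorem IsHoloFamily.eventually_continuousOn {G : ℝ → ℂ → ℂ} (hG : IsHoloFamily G) :
    ∀ᶠ z in 𝓝[stolzAngle τ θ] τ, ContinuousOn (fun s => G s z) (Icc 0 T) := by
  filter_upwards [self_mem_nhdsWithin] with z hz
  exact (hG.continuousOn_time (stolzAngle_subset_ball hz)).mono Icc_subset_Ici_self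

theorem IsContinuousSemigroup.hasBddLimit_deriv (hF : IsContinuousSemigroup F)
    (hf : IsGenerator f F) (hτ : IsBoundaryNullPoint f τ) (hβ : HasAngularLimit (deriv f) τ β)
    (h0 : 0 < θ) (h1 : θ < Real.pi / 2) (hT : 0 ≤ T) :
    HasBddLimit (𝓝[stolzAngle τ θ] τ) T (fun s => deriv (F s))
      (fun t => Complex.exp (-∫ _ in (0 : ℝ)..t, β)) := by
  refine (((hF.hasBddLimit_comp hf hτ hβ h0 h1 hT hβ).integral
    (hF.isHoloFamily_comp (hf.holo.deriv isOpen_ball)).eventually_continuousOn).neg.cexp).congr ?_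
  filter_upwards [self_mem_nhdsWithin] with z hz s hs
  exact hF.deriv_eq_exp hf hs.1 (stolzAngle_subset_ball hz)

theorem IsContinuousSemigroup.hasBddLimit_deriv_deriv (hF : IsContinuousSemigroup F)
    (hf : IsGenerator f F) (hτ : IsBoundaryNullPoint f τ) (hβ : HasAngularLimit (deriv f) τ β)
    (hα : HasAngularLimit (deriv (deriv f)) τ α) (h0 : 0 < θ) (h1 : θ < Real.pi / 2)
    (hT : 0 ≤ T) {A : ℝ → ℂ}
    (hA : HasBddLimit (𝓝[stolzAngle τ θ] τ) T (fun s => deriv (F s)) A) :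
    HasBddLimit (𝓝[stolzAngle τ θ] τ) T (fun s => deriv (deriv (F s)))
      (fun t => A t * -∫ s in (0 : ℝ)..t, α * A s) := by
  have hf2 := (hf.holo.deriv isOpen_ball).deriv isOpen_ball
  refine (hA.mul (((hF.hasBddLimit_comp hf hτ hβ h0 h1 hT hα).mul hA).integral
    ((hF.isHoloFamily_comp hf2).mul
      hF.isHoloFamily.deriv).eventually_continuousOn).neg).congr ?_
  filter_upwards [self_mem_nhdsWithin] with z hz s hs
  exact hF.deriv_deriv_eq hf hs.1 (stolzAngle_subset_ball hz)

theorem IsContinuousSemigroup.hasBddLimit_deriv_deriv_deriv (hF : IsContinuousSemigroup F)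
    (hf : IsGenerator f F) (hτ : IsBoundaryNullPoint f τ) (hβ : HasAngularLimit (deriv f) τ β)
    (hα : HasAngularLimit (deriv (deriv f)) τ α)
    (hγ : HasAngularLimit (deriv (deriv (deriv f))) τ γ) (h0 : 0 < θ) (h1 : θ < Real.pi / 2)
    (hT : 0 ≤ T) {A B : ℝ → ℂ}
    (hA : HasBddLimit (𝓝[stolzAngle τ θ] τ) T (fun s => deriv (F s)) A)
    (hB : HasBddLimit (𝓝[stolzAngle τ θ] τ) T (fun s => deriv (deriv (F s))) B) :
    HasBddLimit (𝓝[stolzAngle τ θ] τ) T (fun s => deriv (deriv (deriv (F s))))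
      (fun t => B t * (-∫ s in (0 : ℝ)..t, α * A s) +
        A t * -∫ s in (0 : ℝ)..t, (γ * A s * A s + α * B s)) := by
  have hf2 := (hf.holo.deriv isOpen_ball).deriv isOpen_ball
  have hf3 := hf2.deriv isOpen_ball
  have hc2 := hF.isHoloFamily_comp hf2
  have hc3 := hF.isHoloFamily_comp hf3
  have hd := hF.isHoloFamily.deriv
  have hI1 := ((hF.hasBddLimit_comp hf hτ hβ h0 h1 hT hα).mul hA).integral
    (hc2.mul hd).eventually_continuousOn
  have hI2 := (((hF.hasBddLimit_comp hf hτ hβ h0 h1 hT hγ).mul hA).mul hA |>.add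
    ((hF.hasBddLimit_comp hf hτ hβ h0 h1 hT hα).mul hB)).integral (by
      filter_upwards [((hc3.mul hd).mul hd).eventually_continuousOn,
        (hc2.mul hd.deriv).eventually_continuousOn] with z h1 h2 using h1.add h2)
  refine ((hB.mul hI1.neg).add (hA.mul hI2.neg)).congr ?_
  filter_upwards [self_mem_nhdsWithin] with z hz s hs
  exact hF.deriv_deriv_deriv_eq hf hs.1 (stolzAngle_subset_ball hz)

theorem hasAngularDeriv_one_iff {h : ℂ → ℂ} {L : ℂ} :
    HasAngularDeriv 1 h τ L ↔ HasAngularLimit (deriv h) τ L := by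
  rw [HasAngularDeriv, iteratedDeriv_one]

theorem hasAngularDeriv_two_iff {h : ℂ → ℂ} {L : ℂ} :
    HasAngularDeriv 2 h τ L ↔ HasAngularLimit (deriv (deriv h)) τ L := by
  rw [HasAngularDeriv, iteratedDeriv_succ, iteratedDeriv_one]

theorem hasAngularDeriv_three_iff {h : ℂ → ℂ} {L : ℂ} :
    HasAngularDeriv 3 h τ L ↔ HasAngularLimit (deriv (deriv (deriv h))) τ L := by
  rw [HasAngularDeriv, iteratedDeriv_succ, iteratedDeriv_succ, iteratedDeriv_one]

/-! ### Evaluation of the limits -/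

theorem exp_neg_integral_const (β : ℂ) (t : ℝ) :
    Complex.exp (-∫ _ in (0 : ℝ)..t, β) = Complex.exp (-β * t) := by
  rw [intervalIntegral.integral_const, sub_zero, Complex.real_smul]
  congr 1
  ring

theorem hasDerivAt_exp_neg_mul (β : ℂ) (s : ℝ) :
    HasDerivAt (fun s : ℝ => Complex.exp (-β * s)) (-β * Complex.exp (-β * s)) s := by
  have h : HasDerivAt (fun s : ℝ => -β * (s : ℂ)) (-β) s := by
    simpa using (Complex.ofRealCLM.hasDerivAt (x := s)).const_mul (-β)
  exact h.cexp.congr_deriv (by ring)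

theorem integral_const_mul_exp_neg_mul (hβ : β ≠ 0) (α : ℂ) (t : ℝ) :
    ∫ s in (0 : ℝ)..t, α * Complex.exp (-β * s) = α / β * (1 - Complex.exp (-β * t)) := by
  rw [intervalIntegral.integral_eq_sub_of_hasDerivAt
    (f := fun s : ℝ => -(α / β) * Complex.exp (-β * s))
    (fun s _ => ((hasDerivAt_exp_neg_mul β s).const_mul _).congr_deriv (by field_simp))
    (Continuous.intervalIntegrable (by fun_prop) _ _)]
  simp
  ring

theorem IsContinuousSemigroup.hasAngularDeriv_one (hF : IsContinuousSemigroup F)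
    (hf : IsGenerator f F) (hτ : IsBoundaryNullPoint f τ) (hβ : HasAngularDeriv 1 f τ β) {t : ℝ}
    (ht : 0 ≤ t) : HasAngularDeriv 1 (F t) τ (Complex.exp (-β * t)) := by
  rw [hasAngularDeriv_one_iff] at hβ ⊢
  intro θ h0 h1
  rw [← exp_neg_integral_const]
  exact (hF.hasBddLimit_deriv hf hτ hβ h0 h1 ht).tendsto t ⟨ht, le_rfl⟩

theorem IsContinuousSemigroup.hasAngularDeriv_two (hF : IsContinuousSemigroup F)
    (hf : IsGenerator f F) (hτ : IsBoundaryNullPoint f τ) (hβ : HasAngularDeriv 1 f τ β)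
    (hα : HasAngularDeriv 2 f τ α) {t : ℝ} (ht : 0 ≤ t) :
    HasAngularDeriv 2 (F t) τ
      (Complex.exp (-β * t) * -∫ s in (0 : ℝ)..t, α * Complex.exp (-β * s)) := by
  rw [hasAngularDeriv_one_iff] at hβ
  rw [hasAngularDeriv_two_iff] at hα ⊢
  intro θ h0 h1
  have hA := hF.hasBddLimit_deriv hf hτ hβ h0 h1 ht
  simp only [exp_neg_integral_const] at hA
  exact (hF.hasBddLimit_deriv_deriv hf hτ hβ hα h0 h1 ht hA).tendsto t ⟨ht, le_rfl⟩

/-- `B` is a parameter so that the second-order limit can be supplied in closed form, already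
evaluated for `β = 0` or `β ≠ 0`. -/
theorem IsContinuousSemigroup.hasAngularDeriv_three (hF : IsContinuousSemigroup F)
    (hf : IsGenerator f F) (hτ : IsBoundaryNullPoint f τ) (hβ : HasAngularDeriv 1 f τ β)
    (hα : HasAngularDeriv 2 f τ α) (hγ : HasAngularDeriv 3 f τ γ) {t : ℝ} (ht : 0 ≤ t) {B : ℝ → ℂ}
    (hB : ∀ s, B s = Complex.exp (-β * s) * -∫ r in (0 : ℝ)..s, α * Complex.exp (-β * r)) :
    HasAngularDeriv 3 (F t) τ
      (B t * (-∫ s in (0 : ℝ)..t, α * Complex.exp (-β * s)) + Complex.exp (-β * t) *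
        -∫ s in (0 : ℝ)..t, (γ * Complex.exp (-β * s) * Complex.exp (-β * s) + α * B s)) := by
  rw [hasAngularDeriv_one_iff] at hβ
  rw [hasAngularDeriv_two_iff] at hα
  rw [hasAngularDeriv_three_iff] at hγ ⊢
  obtain rfl : B = _ := funext hB
  intro θ h0 h1
  have hA := hF.hasBddLimit_deriv hf hτ hβ h0 h1 ht
  simp only [exp_neg_integral_const] at hA
  have hB := hF.hasBddLimit_deriv_deriv hf hτ hβ hα h0 h1 ht hA
  exact (hF.hasBddLimit_deriv_deriv_deriv hf hτ hβ hα hγ h0 h1 ht hA hB).tendsto t ⟨ht, le_rfl⟩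

theorem IsContinuousSemigroup.hasAngularDeriv_two_of_eq_zero (hF : IsContinuousSemigroup F)
    (hf : IsGenerator f F) (hτ : IsBoundaryNullPoint f τ) (hβ : HasAngularDeriv 1 f τ 0)
    (hα : HasAngularDeriv 2 f τ α) {t : ℝ} (ht : 0 ≤ t) :
    HasAngularDeriv 2 (F t) τ (-α * t) := by
  convert hF.hasAngularDeriv_two hf hτ hβ hα ht using 1
  simp [mul_comm]

theorem IsContinuousSemigroup.hasAngularDeriv_two_of_ne_zero (hF : IsContinuousSemigroup F)
    (hf : IsGenerator f F) (hτ : IsBoundaryNullPoint f τ) (hβ : HasAngularDeriv 1 f τ β)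
    (hα : HasAngularDeriv 2 f τ α) (hβ0 : β ≠ 0) {t : ℝ} (ht : 0 ≤ t) :
    HasAngularDeriv 2 (F t) τ
      (α / β * Complex.exp (-β * t) * (Complex.exp (-β * t) - 1)) := by
  convert hF.hasAngularDeriv_two hf hτ hβ hα ht using 1
  rw [integral_const_mul_exp_neg_mul hβ0]
  ring

theorem IsContinuousSemigroup.hasAngularDeriv_three_of_eq_zero (hF : IsContinuousSemigroup F)
    (hf : IsGenerator f F) (hτ : IsBoundaryNullPoint f τ) (hβ : HasAngularDeriv 1 f τ 0)
    (hα : HasAngularDeriv 2 f τ α) (hγ : HasAngularDeriv 3 f τ γ) {t : ℝ} (ht : 0 ≤ t) :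
    HasAngularDeriv 3 (F t) τ (3 / 2 * α ^ 2 * (t : ℂ) ^ 2 - γ * t) := by
  convert hF.hasAngularDeriv_three hf hτ hβ hα hγ ht (B := fun s => -(α * s))
    (fun s => by simp [mul_comm]) using 1
  have hI : ∫ s in (0 : ℝ)..t, (γ + α * -(α * s)) = γ * t - α ^ 2 / 2 * t ^ 2 := by
    have hid : ∀ s : ℝ, HasDerivAt (fun s : ℝ => (s : ℂ)) 1 s := fun s =>
      Complex.ofRealCLM.hasDerivAt (x := s)
    rw [intervalIntegral.integral_eq_sub_of_hasDerivAt
      (f := fun s : ℝ => γ * (s : ℂ) - α ^ 2 / 2 * (s : ℂ) ^ 2)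
      (fun s _ => (((hid s).const_mul γ).sub (((hid s).pow 2).const_mul _)).congr_deriv
        (by push_cast; ring))
      (Continuous.intervalIntegrable (by fun_prop) _ _)]
    simp
  simp only [neg_zero, zero_mul, Complex.exp_zero, mul_one, one_mul, hI,
    intervalIntegral.integral_const, sub_zero, Complex.real_smul]
  ring

theorem IsContinuousSemigroup.hasAngularDeriv_three_of_ne_zero (hF : IsContinuousSemigroup F)
    (hf : IsGenerator f F) (hτ : IsBoundaryNullPoint f τ) (hβ : HasAngularDeriv 1 f τ β)
    (hα : HasAngularDeriv 2 f τ α) (hγ : HasAngularDeriv 3 f τ γ) (hβ0 : β ≠ 0) {t : ℝ}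
    (ht : 0 ≤ t) :
    HasAngularDeriv 3 (F t) τ
      ((3 * α ^ 2 / (2 * β ^ 2) + γ / (2 * β)) * Complex.exp (-3 * β * t)
        - 3 * (α ^ 2 / β ^ 2) * Complex.exp (-2 * β * t)
        + (3 * α ^ 2 / (2 * β ^ 2) - γ / (2 * β)) * Complex.exp (-β * t)) := by
  convert hF.hasAngularDeriv_three hf hτ hβ hα hγ ht
    (B := fun s => Complex.exp (-β * s) * -(α / β * (1 - Complex.exp (-β * s))))
    (fun s => by rw [integral_const_mul_exp_neg_mul hβ0]) using 1
  have hI : ∫ s in (0 : ℝ)..t, (γ * Complex.exp (-β * s) * Complex.exp (-β * s) +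
      α * (Complex.exp (-β * s) * -(α / β * (1 - Complex.exp (-β * s))))) =
      (γ + α ^ 2 / β) / (2 * β) * (1 - Complex.exp (-β * t) ^ 2)
        - α ^ 2 / β ^ 2 * (1 - Complex.exp (-β * t)) := by
    -- With `E = exp (-β s)` the integrand is `(γ + α²/β) E² - (α²/β) E`, and `E' = -β E`.
    rw [intervalIntegral.integral_eq_sub_of_hasDerivAt
      (f := fun s : ℝ => -((γ + α ^ 2 / β) / (2 * β)) * Complex.exp (-β * s) ^ 2
        + α ^ 2 / β ^ 2 * Complex.exp (-β * s))
      (fun s _ => ((((hasDerivAt_exp_neg_mul β s).pow 2).const_mul _).add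
        ((hasDerivAt_exp_neg_mul β s).const_mul _)).congr_deriv (by
          push_cast
          field_simp
          ring))
      (Continuous.intervalIntegrable (by fun_prop) _ _)]
    simp
    ring
  -- Once all exponentials are powers of `exp (-β t)`, the claim is an algebraic identity in that
  -- quantity.
  have e2 : Complex.exp (-2 * β * t) = Complex.exp (-β * t) ^ 2 := by
    rw [← Complex.exp_nat_mul]
    congr 1
    push_cast
    ring
  have e3 : Complex.exp (-3 * β * t) = Complex.exp (-β * t) ^ 3 := by
    rw [← Complex.exp_nat_mul]
    congr 1
    push_cast
    ring
  rw [hI, integral_const_mul_exp_neg_mul hβ0, e2, e3]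
  field_simp
  ring

end Limits

theorem theorem1 (F : ℝ → ℂ → ℂ) (f : ℂ → ℂ) (τ : ℂ)
    (hF : IsContinuousSemigroup F) (hf : IsGenerator f F) (hτ : IsBoundaryNullPoint f τ) :
    (∀ β : ℂ, HasAngularDeriv 1 f τ β →
      ∀ t : ℝ, 0 ≤ t → HasAngularDeriv 1 (F t) τ (Complex.exp (-β * t))) ∧
    (∀ α : ℂ, HasAngularDeriv 2 f τ α →
      ∃ β : ℂ, HasAngularDeriv 1 f τ β ∧
        ∀ t : ℝ, 0 ≤ t →
          (β = 0 → HasAngularDeriv 2 (F t) τ (-α * t)) ∧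
          (β ≠ 0 → HasAngularDeriv 2 (F t) τ
            (α / β * Complex.exp (-β * t) * (Complex.exp (-β * t) - 1)))) ∧
    (∀ γ : ℂ, HasAngularDeriv 3 f τ γ →
      ∃ α β : ℂ, HasAngularDeriv 2 f τ α ∧ HasAngularDeriv 1 f τ β ∧
        ∀ t : ℝ, 0 ≤ t →
          (β = 0 → HasAngularDeriv 3 (F t) τ (3 / 2 * α ^ 2 * (t : ℂ) ^ 2 - γ * t)) ∧
          (β ≠ 0 → HasAngularDeriv 3 (F t) τ
            ((3 * α ^ 2 / (2 * β ^ 2) + γ / (2 * β)) * Complex.exp (-3 * β * t)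
              - 3 * (α ^ 2 / β ^ 2) * Complex.exp (-2 * β * t)
              + (3 * α ^ 2 / (2 * β ^ 2) - γ / (2 * β)) * Complex.exp (-β * t)))) := by
  have hd1 := hf.holo.deriv Metric.isOpen_ball
  have h21 : ∀ α, HasAngularDeriv 2 f τ α → ∃ β, HasAngularDeriv 1 f τ β := fun α hα => by
    simp only [hasAngularDeriv_one_iff]
    exact HasAngularLimit.exists_of_deriv hτ.1 hd1 (hasAngularDeriv_two_iff.1 hα)
  have h32 : ∀ γ, HasAngularDeriv 3 f τ γ → ∃ α, HasAngularDeriv 2 f τ α := fun γ hγ => by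
    simp only [hasAngularDeriv_two_iff]
    exact HasAngularLimit.exists_of_deriv hτ.1 (hd1.deriv Metric.isOpen_ball)
      (hasAngularDeriv_three_iff.1 hγ)
  refine ⟨fun β hβ t ht => hF.hasAngularDeriv_one hf hτ hβ ht, fun α hα => ?_, fun γ hγ => ?_⟩
  · obtain ⟨β, hβ⟩ := h21 α hα
    refine ⟨β, hβ, fun t ht => ⟨?_, fun hβ0 =>
      hF.hasAngularDeriv_two_of_ne_zero hf hτ hβ hα hβ0 ht⟩⟩
    rintro rfl
    exact hF.hasAngularDeriv_two_of_eq_zero hf hτ hβ hα ht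
  · obtain ⟨α, hα⟩ := h32 γ hγ
    obtain ⟨β, hβ⟩ := h21 α hα
    refine ⟨α, β, hα, hβ, fun t ht => ⟨?_, fun hβ0 =>
      hF.hasAngularDeriv_three_of_ne_zero hf hτ hβ hα hγ hβ0 ht⟩⟩
    rintro rfl
    exact hF.hasAngularDeriv_three_of_eq_zero hf hτ hβ hα hγ ht
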